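/- **Setting.** Let $\mathcal A$ be the real vector space of smooth $\mathrm{SU}(2)$ connections $A=A^i_a\tau_i\,dx^a$ on $\mathbb R^3$ (trivial bundle, $\tau_i=-\tfrac i2\sigma_i$). Let $\mathcal A_S\subset\mathcal A$ be the set of connections invariant under the Euclidean group acting by $((y,R)\rhd A)(x)=R\,A(R^{-1}(x-y))\,R^{-1}$ for $y\in\mathbb R^3$, $R\in\mathrm{SO}(3)$, where $A(x)=(A^i_a(x))$ is the matrix of components. Fix a non-zero reference connection $\mathring A\in\mathcal A_S$, and put $r:\mathbb R\to\mathcal A$, $r(c)=c\mathring A$. Let $\mathrm{Cyl}$ be the algebra of complex functions on $\mathcal A$ generated by the matrix elements of the holonomies $A\mapsto A(\ell)$ along piecewise analytic paths $\ell$, that is, finite concatenations of analytic curves $[0,1]\to\mathbb R^3$, analytic up to the end points and with nowhere vanishing velocity. Let $\mathrm{Cyl}_F=r^*[\mathrm{Cyl}]=\{\Phi\circ r:\Phi\in\mathrm{Cyl}\}$, an algebra of functions on $\mathbb R$. Let $\mathrm{Cyl}_S$ be the space of finite complex linear combinations of the exponentials $c\mapsto e^{i\mu c}$, $\mu\in\mathbb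 R$. **Statement.** 1. Let $\mathscr V$ be the space of functions in $\mathrm{Cyl}_F$ that vanish at $\pm\infty$. Then $\mathrm{Cyl}_S\subset\mathrm{Cyl}_F$ and, as vector spaces, $\mathrm{Cyl}_F=\mathrm{Cyl}_S\oplus\mathscr V$. Moreover $\mathscr V$ is an ideal in $\mathrm{Cyl}_F$, and the canonical projection $P_S:\mathrm{Cyl}_F\to\mathrm{Cyl}_S$ of this decomposition is multiplicative: $P_S(fg)=(P_Sf)(P_Sg)$ for all $f,g\in\mathrm{Cyl}_F$. 2. Let $\mathscr V_0$ be the space of all continuous functions $\mathbb R\to\mathbb C$ that vanish at $\pm\infty$ and at $0$. Then the sum $\mathrm{Cyl}_S\oplus\mathscr V_0$ is direct and is an algebra of functions, $\mathscr V_0$ is an ideal in it, and its canonical projection $P_S$ onto $\mathrm{Cyl}_S$ is multiplicative: $P_S(fg)=(P_Sf)(P_Sg)$ for all $f,g\in\mathrm{Cyl}_S\oplus\mathscr V_0$. -/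

import Mathlib

open scoped ContDiff

noncomputable section

namespace LQC

/-- The generators `τ₀, τ₁, τ₂` of `su(2)`: `τ_i = -(i/2) σ_i` with `σ_i` the Pauli matrices. -/
def tau : Fin 3 → Matrix (Fin 2) (Fin 2) ℂ :=
  ![(-(Complex.I / 2)) • !![0, 1; 1, 0],
    (-(Complex.I / 2)) • !![0, -Complex.I; Complex.I, 0],
    (-(Complex.I / 2)) • !![1, 0; 0, -1]]

/-- The space `𝒜` of smooth `SU(2)` connections on (the trivial bundle over) space `ℝ³`, as a real
vector space. A connection is given by its components: `A x i a` is `A^i_a(x)`, so that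
`A_a(x) = ∑ i, A x i a • τ_i`. -/
def Connection : Submodule ℝ ((Fin 3 → ℝ) → Matrix (Fin 3) (Fin 3) ℝ) where
  carrier := {A | ∀ i a, ContDiff ℝ ∞ (fun x => A x i a)}
  add_mem' := fun hA hB i a => (hA i a).add (hB i a)
  zero_mem' := fun _ _ => contDiff_const
  smul_mem' := fun _ _ hA i a => contDiff_const.mul (hA i a)

/-- The action of the Euclidean motion `x ↦ R x + y` on a connection: push-forward of the
one-form index `a` by the motion together with the global internal rotation of the index `i`
by `R`, i.e. `(g ▷ A)^i_a(x) = ∑ j b, R^i_j R_a^b A^j_b(R⁻¹(x - y))`. -/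
def euclideanAction (y : Fin 3 → ℝ) (R : Matrix.specialOrthogonalGroup (Fin 3) ℝ)
    (A : (Fin 3 → ℝ) → Matrix (Fin 3) (Fin 3) ℝ) : (Fin 3 → ℝ) → Matrix (Fin 3) (Fin 3) ℝ :=
  fun x => R.1 * A (R.1.transpose.mulVec (x - y)) * R.1.transpose

/-- The set `𝒜_S` of homogeneous and isotropic connections: those fixed by the Euclidean group. -/
def SymmetricConnection : Set Connection :=
  {A | ∀ y R, euclideanAction y R A.1 = A.1}

/-- The `su(2)` matrix `A_a(x) v^a`. -/
def evalConnection (A : Connection) (x v : Fin 3 → ℝ) : Matrix (Fin 2) (Fin 2) ℂ :=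
  ∑ i, ∑ a, ((A.1 x i a * v a : ℝ) : ℂ) • tau i

/-- An analytic edge: a curve `[0,1] → ℝ³`, analytic up to and including the end points and with
nowhere vanishing velocity. Only the values of `toFun` on `[0,1]` matter. -/
structure Edge where
  toFun : ℝ → Fin 3 → ℝ
  analytic : AnalyticOnNhd ℝ toFun (Set.Icc 0 1)
  immersed : ∀ t ∈ Set.Icc (0 : ℝ) 1, deriv toFun t ≠ 0

/-- `U` is the parallel transport of `A` along `e`: `U(0) = 1` and `U' = -A(ė) U` on `[0,1]`. -/
def IsParallelTransport (A : Connection) (e : Edge) (U : ℝ → Matrix (Fin 2) (Fin 2) ℂ) : Prop :=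
  U 0 = 1 ∧ ∀ t ∈ Set.Icc (0 : ℝ) 1, ∀ i j,
    HasDerivWithinAt (fun s => U s i j)
      ((-(evalConnection A (e.toFun t) (deriv e.toFun t) * U t)) i j) (Set.Icc 0 1) t

open Classical in
/-- The holonomy `A(e)` along an analytic edge: the value at time `1` of the parallel transport
(which exists and is unique on `[0,1]`, the equation being linear with continuous coefficients). -/
def edgeHolonomy (A : Connection) (e : Edge) : Matrix (Fin 2) (Fin 2) ℂ :=
  if h : ∃ U, IsParallelTransport A e U then h.choose 1 else 1

/-- A piecewise analytic path: a finite list of analytic edges, traversed one after the other,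
each starting where the previous one ends. -/
structure PiecewiseAnalyticPath where
  edges : List Edge
  chain : edges.IsChain (fun e e' => e.toFun 1 = e'.toFun 0)

/-- The holonomy along successive edges: later edges multiply from the left. -/
def listHolonomy (A : Connection) : List Edge → Matrix (Fin 2) (Fin 2) ℂ
  | [] => 1
  | e :: es => listHolonomy A es * edgeHolonomy A e

/-- The holonomy `A(ℓ)` along a piecewise analytic path. -/
def holonomy (A : Connection) (l : PiecewiseAnalyticPath) : Matrix (Fin 2) (Fin 2) ℂ :=
  listHolonomy A l.edges

/-- The algebra `Cyl` of cylindrical functions on `𝒜`: polynomials in the matrix elements of the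
holonomies along finitely many piecewise analytic paths. -/
def Cyl : Subalgebra ℂ (Connection → ℂ) :=
  Algebra.adjoin ℂ
    {Φ | ∃ (l : PiecewiseAnalyticPath) (i j : Fin 2), Φ = fun A => holonomy A l i j}

/-- The pull-back `r^*` of functions along `r : ℝ → 𝒜`, `r(c) = c A₀`, for a reference
connection `A₀`. -/
def pullback (A₀ : Connection) : (Connection → ℂ) →ₐ[ℂ] (ℝ → ℂ) :=
  AlgHom.pi (fun c => Pi.evalAlgHom ℂ (fun _ : Connection => ℂ) (c • A₀))

/-- The configuration algebra `Cyl_F = r^*[Cyl]`. -/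
def CylF (A₀ : Connection) : Subalgebra ℂ (ℝ → ℂ) :=
  Cyl.map (pullback A₀)

/-- `Cyl_S`: the finite linear combinations of the exponentials `c ↦ e^{iμc}`, `μ ∈ ℝ`. -/
def CylS : Submodule ℂ (ℝ → ℂ) :=
  Submodule.span ℂ (Set.range fun μ : ℝ => fun c : ℝ => Complex.exp (Complex.I * μ * c))

/-- The functions on `ℝ` that vanish at `±∞`. -/
def VanishingAtInfinity : Submodule ℂ (ℝ → ℂ) where
  carrier := {f | Filter.Tendsto f Filter.atTop (nhds 0) ∧ Filter.Tendsto f Filter.atBot (nhds 0)}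
  add_mem' := fun hf hg => ⟨by simpa using! hf.1.add hg.1, by simpa using! hf.2.add hg.2⟩
  zero_mem' := ⟨tendsto_const_nhds, tendsto_const_nhds⟩
  smul_mem' := fun c _ hf => ⟨by simpa using! hf.1.const_smul c, by simpa using! hf.2.const_smul c⟩

/-- The continuous functions on `ℝ` that vanish at `±∞` and at `0`. -/
def VanishingAtInfinityAndZero : Submodule ℂ (ℝ → ℂ) where
  carrier := {f | Continuous f ∧ f ∈ VanishingAtInfinity ∧ f 0 = 0}
  add_mem' := fun hf hg =>
    ⟨hf.1.add hg.1, VanishingAtInfinity.add_mem hf.2.1 hg.2.1, by simp [hf.2.2, hg.2.2]⟩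
  zero_mem' := ⟨continuous_const, VanishingAtInfinity.zero_mem, rfl⟩
  smul_mem' := fun c _ hf =>
    ⟨hf.1.const_smul c, VanishingAtInfinity.smul_mem c hf.2.1, by simp [hf.2.2]⟩

/-- The part of a space `W` of functions that lies in the algebra `B`, as a subspace of `B`. -/
def within (B : Subalgebra ℂ (ℝ → ℂ)) (W : Submodule ℂ (ℝ → ℂ)) : Submodule ℂ B :=
  W.comap B.val.toLinearMap

end LQC

end

/-!
A connection fixed by the Euclidean group has constant components commuting with all rotations, so
`A₀ = k δ^i_a` with `k ≠ 0` (`exists_eq_smul_one_of_symmetric`). Along an edge `e`, the transport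
equation of `c • A₀` therefore reads `U' = i c κ N U` with `κ = k |ė| / 2` and the path of
reflections `N = σ · ė / |ė|`. The parameter `c` is a large frequency, and the question is the
behaviour of `U 1` as `c → ±∞`.

This is answered by an adiabatic argument, valid for every edge, straight or not (`adiabatic`).
Write `N' = κ M` and `K = -(κ/2) N M`. Since `N² = 1` and `N* = N`, the element `K` is skew-adjoint
and the solution `W` of `W' = K W` satisfies `N W = W N(0)` (`kato_intertwine`). With `φ' = κ`, the
product `V = W (e^{icφ} P + e^{-icφ} Q)`, where `P` and `Q` are the spectral projections of `N(0)`,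
then solves `V' = (K + i c κ N) V`. Both `U` and `V` are unitary, and `(U* V)' = U* K V`. But `K` is
the commutator of `M` with the generator divided by a multiple of `c`, so
`U* V - (4ic)⁻¹ U* M V` has a derivative of order `1 / c`. Hence `U(1) = V(1) + O(1 / |c|)`, and the
matrix elements of `V(1)` are combinations of two exponentials. So every element of `Cyl_F` is an
almost periodic function plus one vanishing at infinity (`CylF_le_sup`). Conversely straight edges
along the third axis give all the exponentials (`CylS_le_CylF`).

The rest is algebra. A trigonometric polynomial tending to zero at infinity is zero
(`coeff_eq_zero_of_tendsto`), which makes the sums direct. Multiplying by a bounded function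
preserves vanishing at infinity, so that part is an ideal complementary to the subalgebra `Cyl_S`,
and the projection along an ideal onto a subalgebra is multiplicative
(`IsVanishingIdeal.exists_isCompl`, which is used for both decompositions).
-/

namespace LQC

/-! ### Linear differential equations -/

section LinearODE

variable {𝔸 : Type*} [NormedRing 𝔸] [NormedAlgebra ℝ 𝔸]

/-- On an interval of length at most `1 / (2 M)` the Picard-Lindelöf theorem applies to a linear
equation with arbitrary initial value: a ball of radius `‖x‖` is never left. -/
lemma exists_linearODE_of_short [CompleteSpace 𝔸] {A : ℝ → 𝔸} {M a b : ℝ} (hab : a ≤ b)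
    (hM : 0 ≤ M) (hA : ContinuousOn A (Set.Icc a b)) (hAM : ∀ t ∈ Set.Icc a b, ‖A t‖ ≤ M)
    (hshort : M * (b - a) ≤ 1 / 2) (x : 𝔸) :
    ∃ U : ℝ → 𝔸, U a = x ∧
      ∀ t ∈ Set.Icc a b, HasDerivWithinAt U (A t * U t) (Set.Icc a b) t := by
  have hpl : IsPicardLindelof (fun t y => A t * y) (tmin := a) (tmax := b)
      ⟨a, Set.left_mem_Icc.2 hab⟩ x ‖x‖₊ 0 (⟨M, hM⟩ * (2 * ‖x‖₊)) ⟨M, hM⟩ := by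
    refine ⟨fun t ht => ?_, fun y _ => hA.mul continuousOn_const, fun t ht y hy => ?_, ?_⟩
    · refine LipschitzOnWith.of_dist_le_mul fun y _ z _ => ?_
      rw [dist_eq_norm, dist_eq_norm, ← mul_sub]
      exact (norm_mul_le _ _).trans (mul_le_mul_of_nonneg_right (hAM t ht) (norm_nonneg _))
    · have hy' : ‖y‖ ≤ 2 * ‖x‖ := by
        have h1 : ‖y - x‖ ≤ ‖x‖ := by simpa [dist_eq_norm] using hy
        calc ‖y‖ = ‖(y - x) + x‖ := by rw [sub_add_cancel]
          _ ≤ ‖y - x‖ + ‖x‖ := norm_add_le _ _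
          _ ≤ 2 * ‖x‖ := by linarith
      exact (norm_mul_le _ _).trans (mul_le_mul (hAM t ht) hy' (norm_nonneg _) hM)
    · have h0 : 0 ≤ b - a := sub_nonneg.2 hab
      have := mul_le_mul_of_nonneg_right hshort (mul_nonneg zero_le_two (norm_nonneg x))
      change M * (2 * ‖x‖) * max (b - a) (a - a) ≤ ‖x‖ - 0
      rw [sub_self, max_eq_left h0]
      linarith
  exact hpl.exists_eq_forall_mem_Icc_hasDerivWithinAt₀

/-- Solutions on adjacent intervals with matching values concatenate. -/
lemma hasDerivWithinAt_glue {E : Type*} [NormedAddCommGroup E] [NormedSpace ℝ E]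
    {f : ℝ → E → E} {U V : ℝ → E} {a b c : ℝ} (hab : a ≤ b) (hbc : b ≤ c) (hUV : U b = V b)
    (hU : ∀ t ∈ Set.Icc a b, HasDerivWithinAt U (f t (U t)) (Set.Icc a b) t)
    (hV : ∀ t ∈ Set.Icc b c, HasDerivWithinAt V (f t (V t)) (Set.Icc b c) t) :
    ∀ t ∈ Set.Icc a c, HasDerivWithinAt (fun t => if t ≤ b then U t else V t)
      (f t (if t ≤ b then U t else V t)) (Set.Icc a c) t := by
  set X : ℝ → E := fun t => if t ≤ b then U t else V t with hX
  have hXU : Set.EqOn X U (Set.Icc a b) := fun t ht => if_pos ht.2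
  have hXV : Set.EqOn X V (Set.Icc b c) := fun t ht => by
    rcases eq_or_lt_of_le ht.1 with rfl | h
    · simpa [hX] using hUV
    · exact if_neg (not_le.2 h)
  have h1 : ∀ t ∈ Set.Icc a b, HasDerivWithinAt X (f t (X t)) (Set.Icc a b) t := fun t ht => by
    rw [hXU ht]; exact (hU t ht).congr_of_mem hXU ht
  have h2 : ∀ t ∈ Set.Icc b c, HasDerivWithinAt X (f t (X t)) (Set.Icc b c) t := fun t ht => by
    rw [hXV ht]; exact (hV t ht).congr_of_mem hXV ht
  intro t ht
  change HasDerivWithinAt X (f t (X t)) _ t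
  rcases lt_trichotomy t b with h | rfl | h
  · refine (h1 t ⟨ht.1, h.le⟩).mono_of_mem_nhdsWithin ?_
    filter_upwards [self_mem_nhdsWithin, mem_nhdsWithin_of_mem_nhds (Iio_mem_nhds h)] with s hs hs'
    exact ⟨hs.1, hs'.le⟩
  · rw [← Set.Icc_union_Icc_eq_Icc hab hbc]
    exact (h1 t ⟨hab, le_rfl⟩).union (h2 t ⟨le_rfl, hbc⟩)
  · refine (h2 t ⟨h.le, ht.2⟩).mono_of_mem_nhdsWithin ?_
    filter_upwards [self_mem_nhdsWithin, mem_nhdsWithin_of_mem_nhds (Ioi_mem_nhds h)] with s hs hs'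
    exact ⟨hs'.le, hs.2⟩

/-- A linear equation `U' = A U` with continuous coefficients has a solution on the whole of
`[0, 1]`. -/
theorem exists_linearODE [CompleteSpace 𝔸] {A : ℝ → 𝔸} (hA : ContinuousOn A (Set.Icc 0 1))
    (x : 𝔸) :
    ∃ U : ℝ → 𝔸, U 0 = x ∧
      ∀ t ∈ Set.Icc (0 : ℝ) 1, HasDerivWithinAt U (A t * U t) (Set.Icc 0 1) t := by
  obtain ⟨M, hM⟩ := isCompact_Icc.exists_bound_of_continuousOn hA
  have hM0 : 0 ≤ M := (norm_nonneg _).trans (hM 0 (by simp))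
  -- `N` steps of length `1 / N` are short enough as soon as `N > 2 M`
  obtain ⟨N, hN⟩ := exists_nat_gt (2 * M)
  have hN0 : (0 : ℝ) < N := lt_of_le_of_lt (by positivity) hN
  have key : ∀ n : ℕ, n ≤ N → ∃ U : ℝ → 𝔸, U 0 = x ∧ ∀ t ∈ Set.Icc (0 : ℝ) (n / N),
      HasDerivWithinAt U (A t * U t) (Set.Icc 0 (n / N)) t := by
    intro n
    induction n with
    | zero =>
      intro _
      refine ⟨fun _ => x, rfl, fun t ht => ?_⟩
      have : Set.Icc (0 : ℝ) ((0 : ℕ) / N) = {0} := by simp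
      rw [this] at ht ⊢
      rw [Set.mem_singleton_iff.1 ht]
      exact hasDerivWithinAt_iff_hasFDerivWithinAt.2
        (.of_subsingleton Set.subsingleton_singleton)
    | succ n ih =>
      intro hn
      obtain ⟨U, hU0, hU⟩ := ih (by omega)
      have h0 : (0 : ℝ) ≤ n / N := by positivity
      have h1 : (n : ℝ) / N ≤ ((n + 1 : ℕ) : ℝ) / N := by gcongr; simp
      have h2 : ((n + 1 : ℕ) : ℝ) / N ≤ 1 := (div_le_one hN0).2 (by exact_mod_cast hn)
      have hsub : Set.Icc ((n : ℝ) / N) (((n + 1 : ℕ) : ℝ) / N) ⊆ Set.Icc 0 1 :=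
        Set.Icc_subset_Icc h0 h2
      obtain ⟨V, hV0, hV⟩ := exists_linearODE_of_short h1 hM0 (hA.mono hsub)
        (fun t ht => hM t (hsub ht)) (by
          have : ((n + 1 : ℕ) : ℝ) / N - n / N = 1 / N := by push_cast; ring
          rw [this, mul_one_div, div_le_iff₀ hN0]; linarith) (U (n / N))
      refine ⟨fun t => if t ≤ n / N then U t else V t, by simp [h0, hU0], ?_⟩
      exact hasDerivWithinAt_glue (f := fun t y => A t * y) h0 h1 hV0.symm hU hV
  have := key N le_rfl
  rwa [div_self hN0.ne'] at this

/-- Uniqueness for a linear equation, reduced by linearity to zero initial value. -/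
lemma linearODE_eq_zero {A X : ℝ → 𝔸} (hA : ContinuousOn A (Set.Icc 0 1)) (hX0 : X 0 = 0)
    (hX : ∀ t ∈ Set.Icc (0 : ℝ) 1, HasDerivWithinAt X (A t * X t) (Set.Icc 0 1) t) :
    ∀ t ∈ Set.Icc (0 : ℝ) 1, X t = 0 := by
  obtain ⟨M, hM⟩ := isCompact_Icc.exists_bound_of_continuousOn hA
  refine eq_zero_of_abs_deriv_le_mul_abs_self_of_eq_zero_right (K := M)
    (fun t ht => (hX t ht).continuousWithinAt) (fun t ht =>
      (hX t (Set.Ico_subset_Icc_self ht)).mono_of_mem_nhdsWithin (Icc_mem_nhdsGE_of_mem ht)) hX0 ?_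
  exact fun t ht => (norm_mul_le _ _).trans
    (mul_le_mul_of_nonneg_right (hM t (Set.Ico_subset_Icc_self ht)) (norm_nonneg _))

end LinearODE

/-- A function on `[0, 1]` with vanishing derivative is constant. -/
lemma eq_of_hasDerivWithinAt_zero {E : Type*} [NormedAddCommGroup E] [NormedSpace ℝ E]
    {f : ℝ → E} (hf : ∀ t ∈ Set.Icc (0 : ℝ) 1, HasDerivWithinAt f 0 (Set.Icc 0 1) t) :
    ∀ t ∈ Set.Icc (0 : ℝ) 1, f t = f 0 := by
  intro t ht
  have := norm_image_sub_le_of_norm_deriv_le_segment' (C := 0) hf (by simp) t ht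
  rw [zero_mul, norm_le_zero_iff, sub_eq_zero] at this
  exact this

/-- A continuous function on `[0, 1]` has a primitive there that vanishes at `0`. -/
lemma exists_primitive {κ : ℝ → ℝ} (hκ : ContinuousOn κ (Set.Icc 0 1)) :
    ∃ φ : ℝ → ℝ, φ 0 = 0 ∧
      ∀ t ∈ Set.Icc (0 : ℝ) 1, HasDerivWithinAt φ (κ t) (Set.Icc 0 1) t := by
  refine ⟨ODE.picard (fun t _ => κ t) 0 0 (fun _ => (0 : ℝ)), by simp, fun t ht => ?_⟩
  exact ODE.hasDerivWithinAt_picard_Icc (f := fun t _ => κ t) (u := Set.univ) (by simp)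
    (hκ.comp continuousOn_fst fun p hp => hp.1) continuousOn_const (by simp) 0 ht

/-! ### The adiabatic theorem for a reflection-valued generator -/

section Adiabatic

variable {𝔸 : Type*} [CStarAlgebra 𝔸]

/-- A linear equation with skew-adjoint coefficients preserves `U* U`. -/
lemma star_mul_self_of_skewAdjoint {G U : ℝ → 𝔸} (hG : ∀ t ∈ Set.Icc (0 : ℝ) 1, star (G t) = -G t)
    (hU0 : U 0 = 1)
    (hU : ∀ t ∈ Set.Icc (0 : ℝ) 1, HasDerivWithinAt U (G t * U t) (Set.Icc 0 1) t) :
    ∀ t ∈ Set.Icc (0 : ℝ) 1, star (U t) * U t = 1 := by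
  intro t ht
  have h : ∀ t ∈ Set.Icc (0 : ℝ) 1,
      HasDerivWithinAt (fun t => star (U t) * U t) 0 (Set.Icc 0 1) t := fun t ht => by
    convert! (hU t ht).star.mul (hU t ht) using 1
    rw [star_mul, hG t ht]
    noncomm_ring
  rw [eq_of_hasDerivWithinAt_zero h t ht, hU0]
  simp

lemma norm_le_one_of_star_mul_self {u : 𝔸} (hu : star u * u = 1) : ‖u‖ ≤ 1 := by
  nontriviality 𝔸
  have := CStarRing.norm_star_mul_self (x := u)
  rw [hu, norm_one] at this
  nlinarith [norm_nonneg u]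

/-- Kato's geometric transport: if `N' = κ M` with `N² = 1`, the solution `W` of
`W' = -(κ/2) N M W` intertwines `N 0` with `N t`. -/
lemma kato_intertwine {N M W : ℝ → 𝔸} {κ : ℝ → ℝ} (hκ : ContinuousOn κ (Set.Icc 0 1))
    (hMc : ContinuousOn M (Set.Icc 0 1))
    (hN : ∀ t ∈ Set.Icc (0 : ℝ) 1, HasDerivWithinAt N ((κ t : ℂ) • M t) (Set.Icc 0 1) t)
    (hNN : ∀ t ∈ Set.Icc (0 : ℝ) 1, N t * N t = 1)
    (hanti : ∀ t ∈ Set.Icc (0 : ℝ) 1, M t * N t = -(N t * M t))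
    (hW0 : W 0 = 1)
    (hW : ∀ t ∈ Set.Icc (0 : ℝ) 1,
      HasDerivWithinAt W ((-(κ t / 2) : ℂ) • (N t * M t) * W t) (Set.Icc 0 1) t) :
    ∀ t ∈ Set.Icc (0 : ℝ) 1, N t * W t = W t * N 0 := by
  have hNc : ContinuousOn N (Set.Icc 0 1) := fun t ht => (hN t ht).continuousWithinAt
  have hκc : ContinuousOn (fun t => (-(κ t / 2) : ℂ)) (Set.Icc 0 1) :=
    ((Complex.continuous_ofReal.comp_continuousOn hκ).div_const 2).neg
  have key := linearODE_eq_zero (A := fun t => (-(κ t / 2) : ℂ) • (N t * M t))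
    (X := fun t => N t * W t - W t * N 0) (hκc.smul (hNc.mul hMc)) (by simp [hW0]) (fun t ht => by
      convert! ((hN t ht).mul (hW t ht)).sub ((hW t ht).mul_const (N 0)) using 1
      have h1 : N t * (N t * M t) = M t := by rw [← mul_assoc, hNN t ht, one_mul]
      have h2 : N t * (M t * N t) = -M t := by rw [hanti t ht, mul_neg, h1]
      have e1 : N t * (M t * (N t * W t)) = -(M t * W t) := by
        rw [← neg_mul, ← h2]; simp only [mul_assoc]
      have e2 : N t * (N t * (M t * W t)) = M t * W t := by
        rw [← mul_assoc (N t) (M t), ← mul_assoc (N t), h1]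
      simp only [mul_sub, smul_mul_assoc, mul_smul_comm, mul_assoc, e1, e2]
      module)
  exact fun t ht => sub_eq_zero.1 (key t ht)

/-- **Adiabatic theorem.** Let `N` be a path of self-adjoint involutions with `N' = κ M`, where `M`
is continuously differentiable and `κ` does not vanish. As `|c| → ∞`, the solution at time `1` of
`U' = i c κ N U` is, up to an error of order `1 / |c|`, the dynamical phases `exp (± i c Θ)` on the
two eigenspaces of `N 0`, followed by an operator independent of `c`. -/
theorem adiabatic [IsDedekindFiniteMonoid 𝔸] {N M M' : ℝ → 𝔸} {κ : ℝ → ℝ}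
    (hκ : ContinuousOn κ (Set.Icc 0 1)) (hκ0 : ∀ t ∈ Set.Icc (0 : ℝ) 1, κ t ≠ 0)
    (hM'c : ContinuousOn M' (Set.Icc 0 1))
    (hN : ∀ t ∈ Set.Icc (0 : ℝ) 1, HasDerivWithinAt N ((κ t : ℂ) • M t) (Set.Icc 0 1) t)
    (hM : ∀ t ∈ Set.Icc (0 : ℝ) 1, HasDerivWithinAt M (M' t) (Set.Icc 0 1) t)
    (hNN : ∀ t ∈ Set.Icc (0 : ℝ) 1, N t * N t = 1)
    (hNs : ∀ t ∈ Set.Icc (0 : ℝ) 1, star (N t) = N t) :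
    ∃ (W P Q : 𝔸) (Θ C : ℝ), ∀ c : ℝ, c ≠ 0 → ∀ U : ℝ → 𝔸, U 0 = 1 →
      (∀ t ∈ Set.Icc (0 : ℝ) 1,
        HasDerivWithinAt U ((Complex.I * c * κ t) • N t * U t) (Set.Icc 0 1) t) →
      ‖U 1 - W * (Complex.exp (Complex.I * Θ * c) • P +
        Complex.exp (Complex.I * (-Θ : ℝ) * c) • Q)‖ ≤ C / |c| := by
  have hu : ∀ t ∈ Set.Icc (0 : ℝ) 1, UniqueDiffWithinAt ℝ (Set.Icc (0 : ℝ) 1) t :=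
    fun t ht => uniqueDiffOn_Icc zero_lt_one t ht
  have hκ0' : ∀ t ∈ Set.Icc (0 : ℝ) 1, (κ t : ℂ) ≠ 0 := fun t ht => by exact_mod_cast hκ0 t ht
  have hNc : ContinuousOn N (Set.Icc 0 1) := fun t ht => (hN t ht).continuousWithinAt
  have hMc : ContinuousOn M (Set.Icc 0 1) := fun t ht => (hM t ht).continuousWithinAt
  -- differentiate `N² = 1` and `N* = N`
  have hanti : ∀ t ∈ Set.Icc (0 : ℝ) 1, M t * N t = -(N t * M t) := fun t ht => by
    have h1 := (hN t ht).mul (hN t ht)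
    have h2 : HasDerivWithinAt (fun t => N t * N t) 0 (Set.Icc 0 1) t :=
      (hasDerivWithinAt_const t _ (1 : 𝔸)).congr_of_mem hNN ht
    have h3 := (hu t ht).eq_deriv _ h1 h2
    rw [smul_mul_assoc, mul_smul_comm, ← smul_add, smul_eq_zero_iff_right (hκ0' t ht)] at h3
    exact eq_neg_of_add_eq_zero_left h3
  have hMs : ∀ t ∈ Set.Icc (0 : ℝ) 1, star (M t) = M t := fun t ht => by
    have h1 := (hN t ht).star
    have h2 : HasDerivWithinAt (fun t => star (N t)) ((κ t : ℂ) • M t) (Set.Icc 0 1) t :=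
      (hN t ht).congr_of_mem hNs ht
    have h3 := (hu t ht).eq_deriv _ h1 h2
    rw [star_smul] at h3
    refine (smul_right_injective 𝔸 (hκ0' t ht)) ?_
    simpa using h3
  set K : ℝ → 𝔸 := fun t => (-(κ t / 2) : ℂ) • (N t * M t) with hK
  have hKc : ContinuousOn K (Set.Icc 0 1) :=
    ((Complex.continuous_ofReal.comp_continuousOn hκ).div_const 2).neg.smul (hNc.mul hMc)
  have hKs : ∀ t ∈ Set.Icc (0 : ℝ) 1, star (K t) = -K t := fun t ht => by
    simp [hK, star_smul, star_mul, hNs t ht, hMs t ht, hanti t ht]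
  obtain ⟨W, hW0, hW⟩ := exists_linearODE hKc (1 : 𝔸)
  have hNW := kato_intertwine hκ hMc hN hNN hanti hW0 hW
  obtain ⟨φ, hφ0, hφ⟩ := exists_primitive hκ
  obtain ⟨B₁, hB₁⟩ := isCompact_Icc.exists_bound_of_continuousOn hMc
  obtain ⟨B₂, hB₂⟩ := isCompact_Icc.exists_bound_of_continuousOn (hM'c.add (hMc.mul hKc))
  set P : 𝔸 := (1 / 2 : ℂ) • (1 + N 0) with hP
  set Q : 𝔸 := (1 / 2 : ℂ) • (1 - N 0) with hQ
  have h00 : (0 : ℝ) ∈ Set.Icc (0 : ℝ) 1 := by simp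
  have h11 : (1 : ℝ) ∈ Set.Icc (0 : ℝ) 1 := by simp
  have hPQ : P + Q = 1 := by rw [hP, hQ]; module
  have hNP : N 0 * P = P := by
    rw [hP, mul_smul_comm, mul_add, mul_one, hNN 0 h00, add_comm]
  have hNQ : N 0 * Q = -Q := by
    rw [hQ, mul_smul_comm, mul_sub, mul_one, hNN 0 h00]; module
  refine ⟨W 1, P, Q, φ 1, (B₂ + B₁ + B₁) / 4, fun c hc U hU0 hU => ?_⟩
  set E : ℝ → 𝔸 := fun t => Complex.exp (Complex.I * φ t * c) • P +
    Complex.exp (Complex.I * (-φ t : ℝ) * c) • Q with hE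
  set V : ℝ → 𝔸 := fun t => W t * E t with hV
  set G : ℝ → 𝔸 := fun t => (Complex.I * c * κ t) • N t with hG
  have hGs : ∀ t ∈ Set.Icc (0 : ℝ) 1, star (G t) = -G t := fun t ht => by
    simp [hG, star_smul, hNs t ht]
  have hE' : ∀ t ∈ Set.Icc (0 : ℝ) 1,
      HasDerivWithinAt E ((Complex.I * c * κ t) • (N 0 * E t)) (Set.Icc 0 1) t := fun t ht => by
    have h1 := ((((hφ t ht).ofReal_comp.const_mul Complex.I).mul_const (c : ℂ)).cexp).smul_const P
    have h2 := ((((hφ t ht).neg.ofReal_comp.const_mul Complex.I).mul_const (c : ℂ)).cexp).smul_const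
      Q
    convert! h1.add h2 using 1
    simp only [hE, mul_add, mul_smul_comm, hNP, hNQ, Pi.neg_apply, Complex.ofReal_neg]
    module
  -- the approximate solution `V` solves the equation perturbed by the geometric term `K`
  have hV' : ∀ t ∈ Set.Icc (0 : ℝ) 1,
      HasDerivWithinAt V ((K t + G t) * V t) (Set.Icc 0 1) t := fun t ht => by
    convert! (hW t ht).mul (hE' t ht) using 1
    rw [add_mul, hV, hG]
    simp only [smul_mul_assoc, mul_smul_comm, ← mul_assoc, hNW t ht]
  have hV0 : V 0 = 1 := by simp [hV, hE, hφ0, hW0, hPQ]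
  have hUs := star_mul_self_of_skewAdjoint hGs hU0 hU
  have hVs := star_mul_self_of_skewAdjoint (G := fun t => K t + G t)
    (fun t ht => by rw [star_add, hKs t ht, hGs t ht, neg_add]) hV0 hV'
  have hU1 : ∀ t ∈ Set.Icc (0 : ℝ) 1, ‖star (U t)‖ ≤ 1 := fun t ht => by
    rw [norm_star]; exact norm_le_one_of_star_mul_self (hUs t ht)
  have hV1 : ∀ t ∈ Set.Icc (0 : ℝ) 1, ‖V t‖ ≤ 1 := fun t ht =>
    norm_le_one_of_star_mul_self (hVs t ht)
  have hbd : ∀ t ∈ Set.Icc (0 : ℝ) 1, ∀ (X : 𝔸) (B : ℝ), ‖X‖ ≤ B →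
      ‖star (U t) * X * V t‖ ≤ B := fun t ht X B hX => by
    calc ‖star (U t) * X * V t‖ ≤ ‖star (U t)‖ * ‖X‖ * ‖V t‖ :=
          (norm_mul_le _ _).trans (mul_le_mul_of_nonneg_right (norm_mul_le _ _) (norm_nonneg _))
      _ ≤ 1 * ‖X‖ * 1 := by
          gcongr
          · exact hU1 t ht
          · exact hV1 t ht
      _ ≤ B := by simpa using hX
  -- Integration by parts: `K` is, up to `4 i c`, the commutator of `M` with the generator, so
  -- `U* K V` is a total derivative up to terms of order `1 / c`.
  set z : ℂ := (4 * Complex.I * c)⁻¹ with hz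
  have hc' : (c : ℂ) ≠ 0 := by exact_mod_cast hc
  have hznorm : ‖z‖ = 1 / (4 * |c|) := by simp [hz, Complex.norm_real, mul_comm]
  set D : ℝ → 𝔸 := fun t => star (U t) * V t - z • (star (U t) * M t * V t) with hD
  have hD' : ∀ t ∈ Set.Icc (0 : ℝ) 1,
      HasDerivWithinAt D (-z • (star (U t) * (M' t + M t * K t) * V t)) (Set.Icc 0 1) t :=
    fun t ht => by
    have hUst := (hU t ht).star
    convert! (hUst.mul (hV' t ht)).sub (((hUst.mul (hM t ht)).mul (hV' t ht)).const_smul z) using 1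
    have e1 : star ((Complex.I * c * κ t) • N t * U t) =
        -((Complex.I * c * κ t) • (star (U t) * N t)) := by
      have := hGs t ht
      simp only [hG] at this
      rw [star_mul, this, mul_neg, mul_smul_comm]
    have e2 : star (U t) * (M t * (N t * V t)) = -(star (U t) * (N t * (M t * V t))) := by
      rw [← mul_assoc (M t), hanti t ht, neg_mul, mul_neg, mul_assoc]
    have e3 : (2 * κ t * (z * (Complex.I * c))) • (star (U t) * (N t * (M t * V t))) =
        (κ t / 2 : ℂ) • (star (U t) * (N t * (M t * V t))) := by
      congr 1
      rw [hz]
      field_simp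
      ring
    rw [e1]
    clear_value z
    simp only [hK, hG, smul_mul_assoc, mul_smul_comm, neg_mul, mul_add, add_mul, mul_assoc, e2,
      smul_neg, Pi.mul_apply]
    linear_combination (norm := module) e3.symm
  have hDbd : ‖D 1 - D 0‖ ≤ ‖z‖ * B₂ := by
    refine norm_image_sub_le_of_norm_deriv_le_segment_01' hD' fun t ht => ?_
    rw [norm_smul, norm_neg]
    have ht' := Set.Ico_subset_Icc_self ht
    exact mul_le_mul_of_nonneg_left (hbd t ht' _ _ (hB₂ t ht')) (norm_nonneg _)
  have hUV : ‖star (U 1) * V 1 - 1‖ ≤ ‖z‖ * (B₂ + B₁ + B₁) := by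
    have e : star (U 1) * V 1 - 1 = (D 1 - D 0) + z • (star (U 1) * M 1 * V 1) -
        z • (star (U 0) * M 0 * V 0) := by
      simp only [hD, hU0, hV0, star_one, one_mul, mul_one]
      abel
    rw [e]
    calc _ ≤ ‖D 1 - D 0‖ + ‖z • (star (U 1) * M 1 * V 1)‖ + ‖z • (star (U 0) * M 0 * V 0)‖ :=
          (norm_sub_le _ _).trans (add_le_add_left (norm_add_le _ _) _)
      _ ≤ ‖z‖ * B₂ + ‖z‖ * B₁ + ‖z‖ * B₁ := by
          rw [norm_smul, norm_smul]
          gcongr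
          · exact hbd 1 h11 _ _ (hB₁ 1 h11)
          · exact hbd 0 h00 _ _ (hB₁ 0 h00)
      _ = _ := by ring
  have hUU : U 1 * star (U 1) = 1 := mul_eq_one_symm (hUs 1 h11)
  have e : U 1 - V 1 = -(U 1 * (star (U 1) * V 1 - 1)) := by
    rw [mul_sub, ← mul_assoc, hUU, one_mul, mul_one, neg_sub]
  change ‖U 1 - V 1‖ ≤ _
  rw [e, norm_neg]
  calc _ ≤ ‖U 1‖ * ‖star (U 1) * V 1 - 1‖ := norm_mul_le _ _
    _ ≤ 1 * (‖z‖ * (B₂ + B₁ + B₁)) :=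
        mul_le_mul (norm_le_one_of_star_mul_self (hUs 1 h11)) hUV (norm_nonneg _) zero_le_one
    _ = _ := by rw [hznorm]; field_simp

end Adiabatic

/-! ### Almost periodic functions and functions vanishing at infinity -/

/-- The exponential `c ↦ e^{iμc}`. -/
noncomputable def expMode (μ : ℝ) : ℝ → ℂ := fun c => Complex.exp (Complex.I * μ * c)

lemma expMode_mem (μ : ℝ) : expMode μ ∈ CylS := Submodule.subset_span ⟨μ, rfl⟩

lemma expMode_zero : expMode 0 = 1 := by
  ext c; simp [expMode]

lemma expMode_mul (μ ν : ℝ) : expMode μ * expMode ν = expMode (μ + ν) := by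
  ext c
  simp only [expMode, Pi.mul_apply, ← Complex.exp_add]
  congr 1
  push_cast
  ring

lemma expMode_add (μ c h : ℝ) : expMode μ (c + h) = expMode μ h * expMode μ c := by
  simp only [expMode, ← Complex.exp_add]
  congr 1
  push_cast
  ring

lemma norm_expMode (μ c : ℝ) : ‖expMode μ c‖ = 1 := by
  rw [expMode, show Complex.I * μ * c = ((μ * c : ℝ) : ℂ) * Complex.I by push_cast; ring]
  exact Complex.norm_exp_ofReal_mul_I _

lemma CylS_eq_span : CylS = Submodule.span ℂ (Set.range expMode) := rfl

lemma one_mem_CylS : (1 : ℝ → ℂ) ∈ CylS := expMode_zero ▸ expMode_mem 0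

lemma mul_mem_CylS {f g : ℝ → ℂ} (hf : f ∈ CylS) (hg : g ∈ CylS) : f * g ∈ CylS := by
  rw [CylS_eq_span] at *
  have := Submodule.mul_mem_mul hf hg
  rw [Submodule.span_mul_span] at this
  refine Submodule.span_mono ?_ this
  rintro _ ⟨_, ⟨μ, rfl⟩, _, ⟨ν, rfl⟩, rfl⟩
  exact ⟨μ + ν, (expMode_mul μ ν).symm⟩

lemma continuous_of_mem_CylS {f : ℝ → ℂ} (hf : f ∈ CylS) : Continuous f := by
  induction hf using Submodule.span_induction with
  | mem f hf => obtain ⟨μ, rfl⟩ := hf; fun_prop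
  | zero => exact continuous_const
  | add f g _ _ hf hg => exact hf.add hg
  | smul z f _ hf => exact hf.const_smul z

lemma exists_bound_of_mem_CylS {f : ℝ → ℂ} (hf : f ∈ CylS) : ∃ C, ∀ c, ‖f c‖ ≤ C := by
  induction hf using Submodule.span_induction with
  | mem f hf => obtain ⟨μ, rfl⟩ := hf; exact ⟨1, fun c => (norm_expMode μ c).le⟩
  | zero => exact ⟨0, by simp⟩
  | add f g _ _ hf hg =>
    obtain ⟨C, hC⟩ := hf
    obtain ⟨D, hD⟩ := hg
    exact ⟨C + D, fun c => norm_add_le_of_le (hC c) (hD c)⟩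
  | smul z f _ hf =>
    obtain ⟨C, hC⟩ := hf
    refine ⟨‖z‖ * C, fun c => ?_⟩
    rw [Pi.smul_apply, norm_smul]
    exact mul_le_mul_of_nonneg_left (hC c) (norm_nonneg z)

/-- Distinct frequencies are separated by some translation. -/
lemma exists_expMode_ne {μ ν : ℝ} (h : μ ≠ ν) : ∃ c, expMode μ c ≠ expMode ν c := by
  have h' : μ - ν ≠ 0 := sub_ne_zero.2 h
  refine ⟨Real.pi / (μ - ν), fun heq => ?_⟩
  have e : expMode μ = expMode (μ - ν) * expMode ν := by rw [expMode_mul, sub_add_cancel]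
  have h0 : expMode ν (Real.pi / (μ - ν)) ≠ 0 := Complex.exp_ne_zero _
  rw [e, Pi.mul_apply, mul_eq_right₀ h0, expMode] at heq
  have : Complex.I * ((μ - ν : ℝ) : ℂ) * ((Real.pi / (μ - ν) : ℝ) : ℂ) = Real.pi * Complex.I := by
    rw [mul_assoc, ← Complex.ofReal_mul, mul_div_cancel₀ _ h', mul_comm]
  rw [this, Complex.exp_pi_mul_I] at heq
  norm_num at heq

/-- A trigonometric polynomial tending to zero has no coefficients. For `f` tending to zero, so does
`c ↦ f (c + h) - e^{iμh} f c`, which no longer contains the frequency `μ`. -/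
lemma coeff_eq_zero_of_tendsto (s : Finset ℝ) : ∀ a : ℝ → ℂ,
    Filter.Tendsto (fun c => ∑ ν ∈ s, a ν * expMode ν c) Filter.atTop (nhds 0) →
      ∀ ν ∈ s, a ν = 0 := by
  induction s using Finset.induction_on with
  | empty => simp
  | insert μ s hμ ih =>
    intro a ha
    have hs : ∀ ν ∈ s, a ν = 0 := by
      intro ν hν
      obtain ⟨h, hh⟩ := exists_expMode_ne (show ν ≠ μ by rintro rfl; exact hμ hν)
      have h1 := (ha.comp (Filter.tendsto_atTop_add_const_right _ h Filter.tendsto_id)).sub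
        (ha.const_mul (expMode μ h))
      rw [mul_zero, sub_zero] at h1
      have h2 := ih (fun ν => a ν * (expMode ν h - expMode μ h)) (h1.congr fun c => by
        simp only [Function.comp, id, Finset.sum_insert hμ, expMode_add, mul_add, Finset.mul_sum]
        rw [show ∀ p q r t : ℂ, p = r → p + q - (r + t) = q - t by rintro p q r t rfl; ring,
          ← Finset.sum_sub_distrib]
        · exact Finset.sum_congr rfl fun ν _ => by ring
        · ring) ν hν
      exact (mul_eq_zero.1 h2).resolve_right (sub_ne_zero.2 hh)
    intro ν hν
    rcases Finset.mem_insert.1 hν with rfl | hν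
    · have h1 : Filter.Tendsto (fun c => ‖a ν * expMode ν c‖) Filter.atTop (nhds 0) := by
        refine (tendsto_zero_iff_norm_tendsto_zero.1 ha).congr fun c => ?_
        rw [Finset.sum_insert hμ, Finset.sum_eq_zero fun ν hν => by rw [hs ν hν, zero_mul],
          add_zero]
      simp only [norm_mul, norm_expMode, mul_one] at h1
      exact norm_eq_zero.1 (tendsto_nhds_unique tendsto_const_nhds h1)
    · exact hs ν hν

lemma disjoint_CylS_vanishingAtInfinity : Disjoint CylS VanishingAtInfinity := by
  rw [Submodule.disjoint_def]
  intro f hf hv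
  rw [CylS_eq_span, Finsupp.mem_span_range_iff_exists_finsupp] at hf
  obtain ⟨a, rfl⟩ := hf
  have h0 := coeff_eq_zero_of_tendsto a.support a (hv.1.congr fun c => by
    simp [Finsupp.sum])
  rw [Finsupp.sum]
  exact Finset.sum_eq_zero fun ν hν => by rw [h0 ν hν, zero_smul]

lemma bounded_mul_mem_vanishingAtInfinity {f v : ℝ → ℂ} (hf : ∃ C, ∀ c, ‖f c‖ ≤ C)
    (hv : v ∈ VanishingAtInfinity) : f * v ∈ VanishingAtInfinity := by
  obtain ⟨C, hC⟩ := hf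
  have key : ∀ l : Filter ℝ, Filter.Tendsto v l (nhds 0) → Filter.Tendsto (f * v) l (nhds 0) :=
    fun l hl => squeeze_zero_norm (fun c => (norm_mul_le _ _).trans
      (mul_le_mul_of_nonneg_right (hC c) (norm_nonneg _))) (by simpa using! hl.norm.const_mul C)
  exact ⟨key _ hv.1, key _ hv.2⟩

lemma mul_mem_vanishingAtInfinity {v w : ℝ → ℂ} (hv : v ∈ VanishingAtInfinity)
    (hw : w ∈ VanishingAtInfinity) : v * w ∈ VanishingAtInfinity :=
  ⟨by simpa using! hv.1.mul hw.1, by simpa using! hv.2.mul hw.2⟩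

/-! ### Splitting off an ideal of functions vanishing at infinity -/

/-- `V` is a (possibly non-unital) algebra of functions vanishing at infinity which is stable under
multiplication by almost periodic functions. -/
structure IsVanishingIdeal (V : Submodule ℂ (ℝ → ℂ)) : Prop where
  le : V ≤ VanishingAtInfinity
  mul_mem : ∀ v ∈ V, ∀ w ∈ V, v * w ∈ V
  CylS_mul_mem : ∀ s ∈ CylS, ∀ v ∈ V, s * v ∈ V

lemma isVanishingIdeal_vanishingAtInfinity : IsVanishingIdeal VanishingAtInfinity where
  le := le_rfl
  mul_mem _ hv _ hw := mul_mem_vanishingAtInfinity hv hw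
  CylS_mul_mem _ hs _ hv := bounded_mul_mem_vanishingAtInfinity (exists_bound_of_mem_CylS hs) hv

lemma isVanishingIdeal_vanishingAtInfinityAndZero :
    IsVanishingIdeal VanishingAtInfinityAndZero where
  le _ hv := hv.2.1
  mul_mem v hv w hw := ⟨hv.1.mul hw.1, mul_mem_vanishingAtInfinity hv.2.1 hw.2.1, by simp [hv.2.2]⟩
  CylS_mul_mem s hs v hv := ⟨(continuous_of_mem_CylS hs).mul hv.1,
    bounded_mul_mem_vanishingAtInfinity (exists_bound_of_mem_CylS hs) hv.2.1, by simp [hv.2.2]⟩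

variable {V : Submodule ℂ (ℝ → ℂ)}

lemma IsVanishingIdeal.disjoint (hV : IsVanishingIdeal V) : Disjoint CylS V :=
  disjoint_CylS_vanishingAtInfinity.mono_right hV.le

lemma IsVanishingIdeal.sup_mul_mem (hV : IsVanishingIdeal V) {f v : ℝ → ℂ} (hf : f ∈ CylS ⊔ V)
    (hv : v ∈ V) : f * v ∈ V := by
  obtain ⟨s, hs, w, hw, rfl⟩ := Submodule.mem_sup.1 hf
  rw [add_mul]
  exact V.add_mem (hV.CylS_mul_mem s hs v hv) (hV.mul_mem w hw v hv)

/-- The algebra `Cyl_S ⊕ V`. -/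
def IsVanishingIdeal.sumAlgebra (hV : IsVanishingIdeal V) : Subalgebra ℂ (ℝ → ℂ) :=
  (CylS ⊔ V).toSubalgebra (Submodule.mem_sup_left one_mem_CylS) fun f g hf hg => by
    obtain ⟨s, hs, v, hv, rfl⟩ := Submodule.mem_sup.1 hg
    rw [mul_add]
    refine Submodule.add_mem _ ?_ (Submodule.mem_sup_right (hV.sup_mul_mem hf hv))
    obtain ⟨s', hs', v', hv', rfl⟩ := Submodule.mem_sup.1 hf
    rw [add_mul]
    refine Submodule.add_mem _ (Submodule.mem_sup_left (mul_mem_CylS hs' hs))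
      (Submodule.mem_sup_right ?_)
    rw [mul_comm]
    exact hV.CylS_mul_mem s hs v' hv'

lemma IsVanishingIdeal.toSubmodule_sumAlgebra (hV : IsVanishingIdeal V) :
    Subalgebra.toSubmodule hV.sumAlgebra = CylS ⊔ V :=
  Submodule.toSubalgebra_toSubmodule _ _ _

/-- In any algebra between `Cyl_S` and `Cyl_S ⊕ V`, the part of `V` is an ideal complementary to
the subalgebra `Cyl_S`, so that the projection onto `Cyl_S` is multiplicative. -/
theorem IsVanishingIdeal.exists_isCompl (hV : IsVanishingIdeal V) {B : Subalgebra ℂ (ℝ → ℂ)}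
    (hSB : CylS ≤ Subalgebra.toSubmodule B) (hB : Subalgebra.toSubmodule B ≤ CylS ⊔ V) :
    ∃ h : IsCompl (within B CylS) (within B V),
      (∀ f v : B, v ∈ within B V → f * v ∈ within B V) ∧
      ∀ f g : B, ((Submodule.projectionOnto _ _ h (f * g) : B)) =
        (Submodule.projectionOnto _ _ h f : B) * (Submodule.projectionOnto _ _ h g : B) := by
  have hideal : ∀ f v : B, v ∈ within B V → f * v ∈ within B V := fun f v hv =>
    hV.sup_mul_mem (hB f.2) hv
  have h : IsCompl (within B CylS) (within B V) := by
    constructor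
    · rw [Submodule.disjoint_def]
      exact fun f hs hv => Subtype.ext (Submodule.disjoint_def.1 hV.disjoint f.1 hs hv)
    · rw [codisjoint_iff, eq_top_iff]
      rintro f -
      obtain ⟨s, hs, v, hv, hf⟩ := Submodule.mem_sup.1 (hB f.2)
      refine Submodule.mem_sup.2 ⟨⟨s, hSB hs⟩, hs, f - ⟨s, hSB hs⟩, ?_, add_sub_cancel _ _⟩
      change f.1 - s ∈ V
      rw [← hf, add_sub_cancel_left]
      exact hv
  refine ⟨h, hideal, fun f g => ?_⟩
  have hdec : ∀ f : B, ∃ v ∈ within B V, f = (Submodule.projectionOnto _ _ h f : B) + v :=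
    fun f => ⟨_, Submodule.sub_projection_mem h f, by
      rw [Submodule.coe_projectionOnto_apply, add_sub_cancel]⟩
  obtain ⟨v, hv, hfv⟩ := hdec f
  obtain ⟨w, hw, hgw⟩ := hdec g
  set s := Submodule.projectionOnto _ _ h f
  set t := Submodule.projectionOnto _ _ h g
  have hst : (s : B) * t ∈ within B CylS := mul_mem_CylS s.2 t.2
  have hvw : f * w + t * v ∈ within B V :=
    Submodule.add_mem _ (hideal f w hw) (hideal t v hv)
  have e : f * g = (s : B) * t + (f * w + t * v) := by
    calc f * g = f * (t + w) := by rw [← hgw]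
      _ = (s + v) * t + f * w := by rw [mul_add, ← hfv]
      _ = _ := by ring
  rw [e, Submodule.coe_projectionOnto_apply, map_add, Submodule.projection_apply_of_mem_left h hst,
    Submodule.projection_apply_of_mem_right h hvw, add_zero]

/-! ### Homogeneous and isotropic connections -/

/-- A matrix commuting with all rotations is scalar: two half-turns kill the off-diagonal entries and
a cyclic permutation of the axes identifies the diagonal ones. -/
lemma eq_smul_one_of_rotations {M : Matrix (Fin 3) (Fin 3) ℝ}
    (hM : ∀ R : Matrix.specialOrthogonalGroup (Fin 3) ℝ, R.1 * M * R.1.transpose = M) :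
    M = M 0 0 • (1 : Matrix (Fin 3) (Fin 3) ℝ) := by
  have key : ∀ R : Matrix (Fin 3) (Fin 3) ℝ, R * R.transpose = 1 → R.det = 1 →
      ∀ i j, (R * M * R.transpose) i j = M i j := fun R h1 h2 i j => by
    have := hM ⟨R, Matrix.mem_specialOrthogonalGroup_iff.2
      ⟨Matrix.mem_orthogonalGroup_iff _ _ |>.2 (by
        simpa [Matrix.star_eq_conjTranspose] using h1), h2⟩⟩
    exact congrFun (congrFun this i) j
  have h1 := key !![1, 0, 0; 0, -1, 0; 0, 0, -1]
    (by ext i j; fin_cases i <;> fin_cases j <;> simp [Matrix.mul_apply, Fin.sum_univ_three])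
    (by simp [Matrix.det_fin_three])
  have h2 := key !![-1, 0, 0; 0, -1, 0; 0, 0, 1]
    (by ext i j; fin_cases i <;> fin_cases j <;> simp [Matrix.mul_apply, Fin.sum_univ_three])
    (by simp [Matrix.det_fin_three])
  have h3 := key !![0, 1, 0; 0, 0, 1; 1, 0, 0]
    (by ext i j; fin_cases i <;> fin_cases j <;> simp [Matrix.mul_apply, Fin.sum_univ_three])
    (by simp [Matrix.det_fin_three])
  simp only [Matrix.mul_apply, Fin.sum_univ_three, Matrix.transpose_apply] at h1 h2 h3
  have a01 := h1 0 1
  have a02 := h1 0 2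
  have a10 := h1 1 0
  have a20 := h1 2 0
  have a12 := h2 1 2
  have a21 := h2 2 1
  have a00 := h3 0 0
  have a11 := h3 1 1
  simp at a01 a02 a10 a20 a12 a21 a00 a11
  ext i j
  fin_cases i <;> fin_cases j <;> simp <;> linarith

/-- A homogeneous and isotropic connection is `k • δ^i_a`. -/
lemma exists_eq_smul_one_of_symmetric {A₀ : Connection} (hA₀ : A₀ ∈ SymmetricConnection) :
    ∃ k : ℝ, ∀ x, A₀.1 x = k • (1 : Matrix (Fin 3) (Fin 3) ℝ) := by
  have hconst : ∀ x, A₀.1 x = A₀.1 0 := fun x => by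
    simpa [euclideanAction] using (congrFun (hA₀ x 1) x).symm
  refine ⟨A₀.1 0 0 0, fun x => (hconst x).trans (eq_smul_one_of_rotations fun R => ?_)⟩
  simpa [euclideanAction] using congrFun (hA₀ 0 R) 0

/-! ### Pauli matrices and the direction of an edge -/

/-- The Pauli matrices. -/
def pauli : Fin 3 → Matrix (Fin 2) (Fin 2) ℂ :=
  ![!![0, 1; 1, 0], !![0, -Complex.I; Complex.I, 0], !![1, 0; 0, -1]]

/-- The Hermitian matrix `v · σ`. -/
def pauliVec (v : Fin 3 → ℝ) : Matrix (Fin 2) (Fin 2) ℂ := ∑ i, (v i : ℂ) • pauli i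

lemma pauliVec_eq (v : Fin 3 → ℝ) : pauliVec v =
    !![(v 2 : ℂ), v 0 - Complex.I * v 1; v 0 + Complex.I * v 1, -v 2] := by
  ext i j
  fin_cases i <;> fin_cases j <;> simp [pauliVec, pauli, Fin.sum_univ_three] <;> ring

lemma pauliVec_smul (r : ℝ) (v : Fin 3 → ℝ) : pauliVec (r • v) = (r : ℂ) • pauliVec v := by
  simp only [pauliVec, Finset.smul_sum, smul_smul, Pi.smul_apply, smul_eq_mul,
    Complex.ofReal_mul]

lemma star_pauliVec (v : Fin 3 → ℝ) : star (pauliVec v) = pauliVec v := by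
  rw [pauliVec_eq]
  ext i j
  fin_cases i <;> fin_cases j <;> simp [Matrix.star_apply, sub_eq_add_neg]

lemma pauliVec_mul_self (v : Fin 3 → ℝ) :
    pauliVec v * pauliVec v = ((∑ i, v i ^ 2 : ℝ) : ℂ) • 1 := by
  rw [pauliVec_eq]
  ext i j
  fin_cases i <;> fin_cases j <;>
    simp [Matrix.mul_apply, Fin.sum_univ_two, Fin.sum_univ_three] <;> ring_nf <;> simp

lemma evalConnection_smul {A₀ : Connection} {k : ℝ}
    (hk : ∀ x, A₀.1 x = k • (1 : Matrix (Fin 3) (Fin 3) ℝ)) (c : ℝ) (x v : Fin 3 → ℝ) :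
    -evalConnection (c • A₀) x v = (Complex.I * c * (k / 2)) • pauliVec v := by
  have h : (c • A₀).1 x = (c * k) • (1 : Matrix (Fin 3) (Fin 3) ℝ) := by
    rw [mul_smul, ← hk x]; rfl
  rw [pauliVec_eq]
  ext i j
  fin_cases i <;> fin_cases j <;>
    simp [evalConnection, h, tau, Matrix.one_apply, Fin.sum_univ_three] <;>
    ring_nf

/-- The Euclidean speed of an edge. -/
noncomputable def Edge.speed (e : Edge) (t : ℝ) : ℝ := Real.sqrt (∑ i, deriv e.toFun t i ^ 2)

/-- The reflection `σ · ė / |ė|` attached to the direction of an edge. -/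
noncomputable def Edge.direction (e : Edge) (t : ℝ) : Matrix (Fin 2) (Fin 2) ℂ :=
  pauliVec ((e.speed t)⁻¹ • deriv e.toFun t)

lemma Edge.sum_sq_pos (e : Edge) {t : ℝ} (ht : t ∈ Set.Icc (0 : ℝ) 1) :
    0 < ∑ i, deriv e.toFun t i ^ 2 := by
  obtain ⟨i, hi⟩ := Function.ne_iff.1 (e.immersed t ht)
  exact Finset.sum_pos' (fun _ _ => sq_nonneg _) ⟨i, Finset.mem_univ i, sq_pos_of_ne_zero hi⟩

open scoped Matrix.Norms.L2Operator

/-! ### Holonomies along analytic edges -/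

lemma Edge.speed_sq (e : Edge) (t : ℝ) :
    e.speed t ^ 2 = ∑ i, deriv e.toFun t i ^ 2 :=
  Real.sq_sqrt (Finset.sum_nonneg fun _ _ => sq_nonneg _)

lemma Edge.speed_pos (e : Edge) {t : ℝ} (ht : t ∈ Set.Icc (0 : ℝ) 1) : 0 < e.speed t :=
  Real.sqrt_pos.2 (e.sum_sq_pos ht)

lemma Edge.speed_smul_direction (e : Edge) {t : ℝ} (ht : t ∈ Set.Icc (0 : ℝ) 1) :
    (e.speed t : ℂ) • e.direction t = pauliVec (deriv e.toFun t) := by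
  rw [direction, ← pauliVec_smul, smul_inv_smul₀ (e.speed_pos ht).ne']

lemma Edge.direction_mul_self (e : Edge) {t : ℝ} (ht : t ∈ Set.Icc (0 : ℝ) 1) :
    e.direction t * e.direction t = 1 := by
  have h : ∑ i, ((e.speed t)⁻¹ • deriv e.toFun t) i ^ 2 = 1 := by
    simp only [Pi.smul_apply, smul_eq_mul, mul_pow, ← Finset.mul_sum, ← e.speed_sq t]
    rw [← mul_pow, inv_mul_cancel₀ (e.speed_pos ht).ne', one_pow]
  rw [direction, pauliVec_mul_self, h, Complex.ofReal_one, one_smul]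

lemma Edge.analyticAt_deriv_apply (e : Edge) {t : ℝ} (ht : t ∈ Set.Icc (0 : ℝ) 1) (i : Fin 3) :
    AnalyticAt ℝ (fun t => deriv e.toFun t i) t :=
  analyticAt_pi_iff.1 (e.analytic t ht).deriv i

lemma Edge.analyticAt_speed (e : Edge) {t : ℝ} (ht : t ∈ Set.Icc (0 : ℝ) 1) :
    AnalyticAt ℝ e.speed t := by
  have h : AnalyticAt ℝ (fun t => ∑ i, deriv e.toFun t i ^ 2) t :=
    Finset.analyticAt_fun_sum _ fun i _ => (e.analyticAt_deriv_apply ht i).pow 2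
  exact (h.contDiffAt (n := ω) |>.sqrt (e.sum_sq_pos ht).ne').analyticAt

lemma Edge.analyticAt_direction (e : Edge) {t : ℝ} (ht : t ∈ Set.Icc (0 : ℝ) 1) :
    AnalyticAt ℝ e.direction t := by
  have h : ∀ i, AnalyticAt ℝ
      (fun t => (((e.speed t)⁻¹ * deriv e.toFun t i : ℝ) : ℂ) • pauli i) t := fun i =>
    ((Complex.ofRealCLM.analyticAt _).comp
      (((e.analyticAt_speed ht).fun_inv (e.speed_pos ht).ne').mul
        (e.analyticAt_deriv_apply ht i))).smul analyticAt_const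
  change AnalyticAt ℝ
    (fun t => ∑ i, (((e.speed t)⁻¹ * deriv e.toFun t i : ℝ) : ℂ) • pauli i) t
  exact Finset.analyticAt_fun_sum _ fun i _ => h i

lemma hasDerivWithinAt_matrix_iff {f : ℝ → Matrix (Fin 2) (Fin 2) ℂ}
    {f' : Matrix (Fin 2) (Fin 2) ℂ} {s : Set ℝ} {t : ℝ} :
    HasDerivWithinAt f f' s t ↔
      ∀ i j, HasDerivWithinAt (fun t => f t i j) (f' i j) s t :=
  ⟨fun h i j => hasDerivWithinAt_pi.1 (hasDerivWithinAt_pi.1 h i) j,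
    fun h => hasDerivWithinAt_pi.2 fun i => hasDerivWithinAt_pi.2 fun j => h i j⟩

section Transport

variable {A₀ : Connection} {k : ℝ}

/-- The parallel transport equation of `c • A₀`, with the generator split into its size and its
direction. -/
lemma isParallelTransport_iff (hk : ∀ x, A₀.1 x = k • (1 : Matrix (Fin 3) (Fin 3) ℝ)) (c : ℝ)
    (e : Edge) (U : ℝ → Matrix (Fin 2) (Fin 2) ℂ) :
    IsParallelTransport (c • A₀) e U ↔ U 0 = 1 ∧ ∀ t ∈ Set.Icc (0 : ℝ) 1,
      HasDerivWithinAt U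
        ((Complex.I * c * (k / 2 * e.speed t : ℝ)) • e.direction t * U t) (Set.Icc 0 1) t := by
  refine and_congr_right fun _ => forall₂_congr fun t ht => ?_
  have h : -(evalConnection (c • A₀) (e.toFun t) (deriv e.toFun t) * U t) =
      (Complex.I * c * (k / 2 * e.speed t : ℝ)) • e.direction t * U t := by
    rw [← neg_mul, evalConnection_smul hk, ← e.speed_smul_direction ht, smul_smul]
    congr 2
    push_cast
    ring
  rw [h, hasDerivWithinAt_matrix_iff]

lemma edgeHolonomy_eq {A : Connection} {e : Edge} (h : ∃ U, IsParallelTransport A e U) :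
    ∃ U, IsParallelTransport A e U ∧ edgeHolonomy A e = U 1 :=
  ⟨h.choose, h.choose_spec, dif_pos h⟩

lemma exists_isParallelTransport (hk : ∀ x, A₀.1 x = k • (1 : Matrix (Fin 3) (Fin 3) ℝ)) (c : ℝ)
    (e : Edge) : ∃ U, IsParallelTransport (c • A₀) e U := by
  simp only [isParallelTransport_iff hk]
  refine exists_linearODE (fun t ht => ContinuousAt.continuousWithinAt ?_) 1
  exact ((Complex.continuous_ofReal.continuousAt.comp
    ((e.analyticAt_speed ht).continuousAt.const_mul (k / 2))).const_mul _).smul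
      (e.analyticAt_direction ht).continuousAt

/-- The matrix elements of the holonomy along an analytic edge are almost periodic functions of `c`
up to functions vanishing at infinity. -/
lemma edgeHolonomy_mem (hk : ∀ x, A₀.1 x = k • (1 : Matrix (Fin 3) (Fin 3) ℝ)) (hk0 : k ≠ 0)
    (e : Edge) (i j : Fin 2) :
    (fun c : ℝ => edgeHolonomy (c • A₀) e i j) ∈ CylS ⊔ VanishingAtInfinity := by
  have hκ0 : ∀ t ∈ Set.Icc (0 : ℝ) 1, k / 2 * e.speed t ≠ 0 := fun t ht =>
    mul_ne_zero (div_ne_zero hk0 two_ne_zero) (e.speed_pos ht).ne'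
  have hM : ∀ t ∈ Set.Icc (0 : ℝ) 1, AnalyticAt ℝ
      (fun t => (((k / 2 * e.speed t)⁻¹ : ℝ) : ℂ) • deriv e.direction t) t := fun t ht =>
    ((Complex.ofRealCLM.analyticAt _).comp
      ((analyticAt_const.mul (e.analyticAt_speed ht)).fun_inv (hκ0 t ht))).smul
        (e.analyticAt_direction ht).deriv
  obtain ⟨W, P, Q, Θ, C, hC⟩ := adiabatic (N := e.direction)
    (M' := deriv fun t => (((k / 2 * e.speed t)⁻¹ : ℝ) : ℂ) • deriv e.direction t)
    (κ := fun t => k / 2 * e.speed t)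
    (fun t ht => (((e.analyticAt_speed ht).continuousAt.const_mul (k / 2))).continuousWithinAt) hκ0
    (fun t ht => (hM t ht).deriv.continuousAt.continuousWithinAt)
    (fun t ht => by
      have hne : ((k / 2 * e.speed t : ℝ) : ℂ) ≠ 0 := by exact_mod_cast hκ0 t ht
      rw [smul_smul, Complex.ofReal_inv, mul_inv_cancel₀ hne, one_smul]
      exact (e.analyticAt_direction ht).differentiableAt.hasDerivAt.hasDerivWithinAt)
    (fun t ht => (hM t ht).differentiableAt.hasDerivAt.hasDerivWithinAt)
    (fun t ht => e.direction_mul_self ht) (fun t _ => star_pauliVec _)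
  set S : ℝ → Matrix (Fin 2) (Fin 2) ℂ := fun c =>
    W * (Complex.exp (Complex.I * Θ * c) • P + Complex.exp (Complex.I * (-Θ : ℝ) * c) • Q) with hS
  have hbound : ∀ c : ℝ, c ≠ 0 → ‖edgeHolonomy (c • A₀) e - S c‖ ≤ C * |c|⁻¹ := fun c hc => by
    obtain ⟨U, hU, hU1⟩ := edgeHolonomy_eq (exists_isParallelTransport hk c e)
    rw [isParallelTransport_iff hk] at hU
    rw [hU1, ← div_eq_mul_inv]
    exact hC c hc U hU.1 hU.2
  have hlim : ∀ l : Filter ℝ, Filter.Tendsto (fun c : ℝ => |c|) l Filter.atTop →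
      Filter.Tendsto (fun c => (edgeHolonomy (c • A₀) e - S c) i j) l (nhds 0) := fun l hl => by
    have h1 : Filter.Tendsto (fun c => edgeHolonomy (c • A₀) e - S c) l (nhds 0) := by
      refine squeeze_zero_norm' ?_ (by simpa using! (hl.inv_tendsto_atTop).const_mul C)
      filter_upwards [hl.eventually_gt_atTop 0] with c hc using hbound c (abs_pos.1 hc)
    have h2 : Continuous fun X : Matrix (Fin 2) (Fin 2) ℂ => X i j :=
      continuous_id.matrix_elem i j
    exact (h2.tendsto 0).comp h1
  have hSmem : (fun c => S c i j) ∈ CylS := by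
    have : (fun c => S c i j) = (W * P) i j • expMode Θ + (W * Q) i j • expMode (-Θ) := by
      ext c
      simp only [hS, mul_add, mul_smul_comm, Matrix.add_apply, Matrix.smul_apply, Pi.add_apply,
        Pi.smul_apply, smul_eq_mul, expMode]
      ring
    rw [this]
    exact CylS.add_mem (CylS.smul_mem _ (expMode_mem _)) (CylS.smul_mem _ (expMode_mem _))
  refine Submodule.mem_sup.2 ⟨_, hSmem, fun c => (edgeHolonomy (c • A₀) e - S c) i j,
    ⟨hlim _ Filter.tendsto_abs_atTop_atTop, hlim _ Filter.tendsto_abs_atBot_atTop⟩, ?_⟩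
  ext c
  simp

/-! ### The configuration algebra -/

lemma listHolonomy_mem (hk : ∀ x, A₀.1 x = k • (1 : Matrix (Fin 3) (Fin 3) ℝ)) (hk0 : k ≠ 0)
    (l : List Edge) (i j : Fin 2) : (fun c : ℝ => listHolonomy (c • A₀) l i j) ∈
      isVanishingIdeal_vanishingAtInfinity.sumAlgebra := by
  induction l generalizing i j with
  | nil => exact Subalgebra.algebraMap_mem _ ((1 : Matrix (Fin 2) (Fin 2) ℂ) i j)
  | cons e es ih =>
    have : (fun c : ℝ => listHolonomy (c • A₀) (e :: es) i j) =
        ∑ m, (fun c : ℝ => listHolonomy (c • A₀) es i m) *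
          (fun c : ℝ => edgeHolonomy (c • A₀) e m j) := by
      ext c
      simp [listHolonomy, Matrix.mul_apply, Finset.sum_apply]
    rw [this]
    exact Subalgebra.sum_mem _ fun m _ =>
      Subalgebra.mul_mem _ (ih i m) (edgeHolonomy_mem hk hk0 e m j)

lemma CylF_le_sup (hk : ∀ x, A₀.1 x = k • (1 : Matrix (Fin 3) (Fin 3) ℝ)) (hk0 : k ≠ 0) :
    Subalgebra.toSubmodule (CylF A₀) ≤ CylS ⊔ VanishingAtInfinity := by
  rw [← isVanishingIdeal_vanishingAtInfinity.toSubmodule_sumAlgebra]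
  change CylF A₀ ≤ _
  rw [CylF, Cyl, AlgHom.map_adjoin, Algebra.adjoin_le_iff]
  rintro _ ⟨_, ⟨l, i, j, rfl⟩, rfl⟩
  exact listHolonomy_mem hk hk0 l.edges i j

/-- The straight edge `t ↦ (0, 0, t v)` of displacement `v` along the third axis. -/
def straightEdge (v : ℝ) (hv : v ≠ 0) : Edge where
  toFun t := t • Pi.single 2 v
  analytic _ _ := analyticAt_id.smul analyticAt_const
  immersed t _ := by
    rw [deriv_smul_const differentiableAt_id]
    simpa using hv

lemma edgeHolonomy_straightEdge (hk : ∀ x, A₀.1 x = k • (1 : Matrix (Fin 3) (Fin 3) ℝ)) (c : ℝ)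
    {v : ℝ} (hv : v ≠ 0) :
    edgeHolonomy (c • A₀) (straightEdge v hv) 0 0 = expMode (k / 2 * v) c := by
  obtain ⟨U, ⟨hU0, hU⟩, hU1⟩ :=
    edgeHolonomy_eq (exists_isParallelTransport hk c (straightEdge v hv))
  rw [hU1]
  have hderiv : ∀ t, deriv (straightEdge v hv).toFun t = Pi.single 2 v := fun t => by
    change deriv (fun t : ℝ => t • (Pi.single 2 v : Fin 3 → ℝ)) t = _
    rw [deriv_smul_const differentiableAt_id]
    simp
  set z : ℂ := Complex.I * ((k / 2 * v : ℝ) : ℂ) * c with hz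
  -- the (0,0) entry satisfies a scalar equation, because the generator is diagonal
  have hode : ∀ t ∈ Set.Icc (0 : ℝ) 1,
      HasDerivWithinAt (fun t => U t 0 0) (z * U t 0 0) (Set.Icc 0 1) t := fun t ht => by
    convert! hU t ht 0 0 using 1
    rw [← neg_mul, evalConnection_smul hk, hderiv, pauliVec_eq]
    simp only [Matrix.mul_apply, Fin.sum_univ_two, Matrix.smul_apply, Matrix.of_apply,
      Matrix.cons_val_zero, Matrix.cons_val_one, Pi.single_eq_same, smul_eq_mul, hz,
      Pi.single_eq_of_ne (show (0 : Fin 3) ≠ 2 by decide),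
      Pi.single_eq_of_ne (show (1 : Fin 3) ≠ 2 by decide)]
    push_cast
    ring
  have hconst := eq_of_hasDerivWithinAt_zero
    (f := fun t : ℝ => Complex.exp (-(z * t)) * U t 0 0) (fun t ht => by
      have h1 := (((hasDerivAt_id t).ofReal_comp.const_mul z).neg.cexp).hasDerivWithinAt
        (s := Set.Icc 0 1)
      convert! h1.mul (hode t ht) using 1
      simp
      ring) 1 (by simp)
  simp only [Complex.ofReal_one, mul_one, Complex.ofReal_zero, mul_zero, neg_zero, Complex.exp_zero,
    hU0, Matrix.one_apply_eq, Complex.exp_neg] at hconst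
  rw [inv_mul_eq_one₀ (Complex.exp_ne_zero z)] at hconst
  rw [← hconst, hz, expMode]

lemma CylS_le_CylF (hk : ∀ x, A₀.1 x = k • (1 : Matrix (Fin 3) (Fin 3) ℝ)) (hk0 : k ≠ 0) :
    CylS ≤ Subalgebra.toSubmodule (CylF A₀) := by
  rw [CylS_eq_span, Submodule.span_le]
  rintro _ ⟨μ, rfl⟩
  change expMode μ ∈ CylF A₀
  rcases eq_or_ne μ 0 with rfl | hμ
  · rw [expMode_zero]; exact Subalgebra.one_mem _
  -- a straight edge of displacement `v` carries the frequency `k v / 2`; `v = 0` is no edge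
  · have hv : 2 * μ / k ≠ 0 := div_ne_zero (mul_ne_zero two_ne_zero hμ) hk0
    refine ⟨fun A => holonomy A ⟨[straightEdge (2 * μ / k) hv], List.isChain_singleton _⟩ 0 0,
      Algebra.subset_adjoin ⟨_, 0, 0, rfl⟩, ?_⟩
    ext c
    change ((1 : Matrix (Fin 2) (Fin 2) ℂ) * edgeHolonomy (c • A₀) (straightEdge _ hv)) 0 0 = _
    rw [one_mul, edgeHolonomy_straightEdge hk]
    congr 1
    field_simp

end Transport

end LQC

theorem mainTheorem2 (A₀ : LQC.Connection) (hA₀ : A₀ ∈ LQC.SymmetricConnection) (hne : A₀ ≠ 0) :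
    -- the algebra `Cyl_F = r^*[Cyl] = Cyl_S ⊕ 𝒱`, with `𝒱` its functions vanishing at `±∞`
    (LQC.CylS ≤ Subalgebra.toSubmodule (LQC.CylF A₀) ∧
      ∃ h : IsCompl (LQC.within (LQC.CylF A₀) LQC.CylS)
          (LQC.within (LQC.CylF A₀) LQC.VanishingAtInfinity),
        (∀ f v : LQC.CylF A₀, v ∈ LQC.within (LQC.CylF A₀) LQC.VanishingAtInfinity →
          f * v ∈ LQC.within (LQC.CylF A₀) LQC.VanishingAtInfinity) ∧
        ∀ f g : LQC.CylF A₀,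
          ((Submodule.projectionOnto _ _ h (f * g) : LQC.CylF A₀)) =
            (Submodule.projectionOnto _ _ h f : LQC.CylF A₀) *
              (Submodule.projectionOnto _ _ h g : LQC.CylF A₀)) ∧
    -- the algebra `Cyl_S ⊕ 𝒱₀`, with `𝒱₀` the continuous functions vanishing at `±∞` and at `0`
    (∃ B : Subalgebra ℂ (ℝ → ℂ),
      Subalgebra.toSubmodule B = LQC.CylS ⊔ LQC.VanishingAtInfinityAndZero ∧
      ∃ h : IsCompl (LQC.within B LQC.CylS) (LQC.within B LQC.VanishingAtInfinityAndZero),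
        (∀ f v : B, v ∈ LQC.within B LQC.VanishingAtInfinityAndZero →
          f * v ∈ LQC.within B LQC.VanishingAtInfinityAndZero) ∧
        ∀ f g : B,
          ((Submodule.projectionOnto _ _ h (f * g) : B)) =
            (Submodule.projectionOnto _ _ h f : B) * (Submodule.projectionOnto _ _ h g : B)) := by
  obtain ⟨k, hk⟩ := LQC.exists_eq_smul_one_of_symmetric hA₀
  have hk0 : k ≠ 0 := by
    rintro rfl
    exact hne (Subtype.ext (funext fun x => by rw [hk x, zero_smul]; rfl))
  have hV₀ := LQC.isVanishingIdeal_vanishingAtInfinityAndZero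
  have hB := hV₀.toSubmodule_sumAlgebra
  exact ⟨⟨LQC.CylS_le_CylF hk hk0,
      LQC.isVanishingIdeal_vanishingAtInfinity.exists_isCompl (LQC.CylS_le_CylF hk hk0)
        (LQC.CylF_le_sup hk hk0)⟩,
    hV₀.sumAlgebra, hB, hV₀.exists_isCompl (hB ▸ le_sup_left) hB.le⟩
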